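/- **Theorem 1.2 (Distortion and Wildness).** Let $\Gamma$ be a group with a subgroup $\Lambda$, and let $A$ and $B$ be finite generating sets of $\Gamma$ and $\Lambda$, with word metrics $d_\Gamma$ and $d_\Lambda$. Write $(x\cdot y)_o=\frac12\big(d(x,o)+d(y,o)-d(x,y)\big)$ for the Gromov product of a distance $d$. Suppose that $(\Gamma,d_\Gamma)$ and $(\Lambda,d_\Lambda)$ are hyperbolic, i.e. that for each of them there is $\delta\ge 0$ with $(x\cdot y)_o\ge\min\{(x\cdot z)_o,(y\cdot z)_o\}-\delta$ for all $o,x,y,z$, and that $\Lambda$ is non-elementary, i.e. contains a free subgroup of rank $2$. Fix base points $o\in\Lambda$ and $p\in\Gamma$. The boundary $\partial\Lambda$ is the set of equivalence classes $\lim a_n$ of sequences $(a_n)$ in $\Lambda$ with $(a_m\cdot a_n)_o\to\infty$ as $m,n\to\infty$, where $(a_n)$ and $(b_n)$ are equivalent when $(a_m\cdot b_n)_o\to\infty$ as $m,n\to\infty$; for $\xi,\eta\in\partial\Lambda$ put $(\xi\cdot\eta)_o=\sup\liminf_{m,n\to\infty}(a_m\cdot b_n)_o\in[0,\infty]$, the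 supremum being over all sequences $(a_m)$, $(b_n)$ representing $\xi$, $\eta$. Define $\partial\Gamma$ and its Gromov product likewise with base point $p$. A metric $d$ on a boundary is a visual metric with parameter $r>1$ when there are $k_1,k_2>0$ with $k_1r^{-(\xi\cdot\eta)}\le d(\xi,\eta)\le k_2r^{-(\xi\cdot\eta)}$ for all $\xi,\eta$ (where $r^{-\infty}=0$). Suppose that the Cannon–Thurston map $\hat\imath:\partial\Lambda\to\partial\Gamma$ is well-defined, i.e. that each sequence in $\Lambda$ representing a point of $\partial\Lambda$ represents, as a sequence in $\Gamma$, a point of $\partial\Gamma$, and that this point depends only on the point of $\partial\Lambda$; $\hat\imath$ is the resulting map. Let $d_{\partial\Lambda}$ and $d_{\partial\Gamma}$ be any visual metrics on $\partial\Lambda$ and $\partial\Gamma$, with parameters $r>1$ and $s>1$ respectively. Let $$\varepsilon(\delta)=\sup\{d_{\partial\Gamma}(\hat\imath(\xi),\hat\imath(\eta)) : \xi,\eta\in\partial\Lambda,\ d_{\partial\Lambda}(\xi,\eta)\le\delta\}\in[0,\infty]$$ be the modulus of continuity of $\hat\imath$, and let $$\mathrm{Dist}_\Lambda^\Gamma(n)=\max\{d_\Lambda(e,h)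 : h\in\Lambda,\ d_\Gamma(e,h)\le n\}$$ be the distortion function, for the same word metrics. Then there exist $\alpha,\beta>0$ such that, for all integers $n\ge 0$, $$\varepsilon\!\left(\frac{\beta}{r^{\mathrm{Dist}_\Lambda^\Gamma(n)}}\right)\ \ge\ \frac{\alpha}{s^n}.$$ -/

import Mathlib

open Filter Topology
open scoped ENNReal

namespace CannonThurston

/-! ### Gromov products, hyperbolicity and the Gromov boundary

A distance on `X` is given by its distance function `d : X → X → ℝ`, so that one group can carry
the word metrics of several generating sets. -/

section Boundary

/-- The Gromov product `(x · y)_o = (d(x,o) + d(y,o) - d(x,y)) / 2`. -/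
noncomputable def gromovProduct {X : Type*} (d : X → X → ℝ) (o x y : X) : ℝ :=
  (d x o + d y o - d x y) / 2

/-- `X` is hyperbolic: for some `δ ≥ 0`, `(x · y)_o ≥ min {(x · z)_o, (y · z)_o} - δ` for all
`o, x, y, z`. -/
def IsGromovHyperbolic {X : Type*} (d : X → X → ℝ) : Prop :=
  ∃ δ : ℝ, 0 ≤ δ ∧ ∀ o x y z : X,
    min (gromovProduct d o x z) (gromovProduct d o y z) - δ ≤ gromovProduct d o x y

/-- `(a_m · b_n)_o → ∞` as `m, n → ∞` (both indices independently). -/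
def JointlyDiverge {X : Type*} (d : X → X → ℝ) (o : X) (a b : ℕ → X) : Prop :=
  Tendsto (fun q : ℕ × ℕ => gromovProduct d o (a q.1) (b q.2)) atTop atTop

/-- Sequences `(a_n)` in `X` with `(a_m · a_n)_o → ∞` as `m, n → ∞`. -/
def SeqToInfinity {X : Type*} (d : X → X → ℝ) (o : X) : Type _ :=
  {a : ℕ → X // JointlyDiverge d o a a}

/-- Two sequences as above are equivalent when `(a_m · b_n)_o → ∞` as `m, n → ∞`. -/
def SeqEquiv {X : Type*} (d : X → X → ℝ) (o : X) (a b : SeqToInfinity d o) : Prop :=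
  JointlyDiverge d o a.1 b.1

/-- In a hyperbolic space `SeqEquiv` is an equivalence relation, so that the quotient
`GromovBoundary` below is the set of its classes. -/
theorem seqEquiv_equivalence {X : Type*} {d : X → X → ℝ} (o : X) (hsymm : ∀ x y, d x y = d y x)
    (hd : IsGromovHyperbolic d) : Equivalence (SeqEquiv d o) := by
  have hgp : ∀ x y, gromovProduct d o x y = gromovProduct d o y x := fun x y => by
    unfold gromovProduct; rw [hsymm x y]; ring
  have hs : ∀ {a b : SeqToInfinity d o}, SeqEquiv d o a b → SeqEquiv d o b a := by
    intro a b h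
    have hsw : Tendsto (Prod.swap : ℕ × ℕ → ℕ × ℕ) atTop atTop := by
      rw [← prod_atTop_atTop_eq]; exact tendsto_snd.prodMk tendsto_fst
    exact (h.comp hsw).congr fun q => hgp _ _
  refine ⟨fun a => a.2, hs, ?_⟩
  intro a b c hab hbc
  obtain ⟨δ, -, hδ⟩ := hd
  refine tendsto_atTop.2 fun M => ?_
  obtain ⟨q, hq⟩ := eventually_atTop.1 (tendsto_atTop.1 hab (M + δ))
  obtain ⟨p, hp⟩ := eventually_atTop.1 (tendsto_atTop.1 (hs hbc) (M + δ))
  refine eventually_atTop.2 ⟨(q.1, p.1), fun t ht => ?_⟩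
  have h1 := hq (t.1, max q.2 p.2) ⟨ht.1, le_max_left _ _⟩
  have h2 := hp (t.2, max q.2 p.2) ⟨ht.2, le_max_right _ _⟩
  have h3 := hδ o (a.1 t.1) (c.1 t.2) (b.1 (max q.2 p.2))
  have h4 := le_min h1 h2
  simp only at h4
  linarith

/-- The Gromov boundary `∂X`, defined with reference to the base point `o`: equivalence classes of
sequences tending to infinity. -/
def GromovBoundary {X : Type*} (d : X → X → ℝ) (o : X) : Type _ :=
  Quot (SeqEquiv d o)

/-- The boundary point `lim a_n` represented by a sequence. -/
def GromovBoundary.lim {X : Type*} {d : X → X → ℝ} {o : X} (a : SeqToInfinity d o) :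
    GromovBoundary d o :=
  Quot.mk _ a

/-- The Gromov product of two boundary points, `(ξ · η)_o = sup liminf_{m,n → ∞} (a_m · b_n)_o`,
the supremum over all sequences `(a_m)`, `(b_n)` representing `ξ`, `η`. It may be `∞`; the products
`(a_m · b_n)_o` are non-negative by the triangle inequality. -/
noncomputable def boundaryProduct {X : Type*} (d : X → X → ℝ) (o : X)
    (ξ η : GromovBoundary d o) : ℝ≥0∞ :=
  ⨆ (a : SeqToInfinity d o) (b : SeqToInfinity d o)
    (_ : GromovBoundary.lim a = ξ) (_ : GromovBoundary.lim b = η),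
    liminf (fun q : ℕ × ℕ => ENNReal.ofReal (gromovProduct d o (a.1 q.1) (b.1 q.2))) atTop

/-- `r^{-t}` for `t ∈ [0, ∞]`, with `r^{-∞} = 0`. -/
noncomputable def negPow (r : ℝ) (t : ℝ≥0∞) : ℝ :=
  if t = ∞ then 0 else r ^ (-t.toReal)

/-- The metric `m` on `∂X` is a visual metric with visual parameter `r > 1`: for some
`k₁, k₂ > 0`, `k₁ r^{-(ξ · η)_o} ≤ m(ξ, η) ≤ k₂ r^{-(ξ · η)_o}` for all `ξ, η`. -/
def IsVisualMetric {X : Type*} (d : X → X → ℝ) (o : X) (r : ℝ)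
    (m : MetricSpace (GromovBoundary d o)) : Prop :=
  1 < r ∧ ∃ k₁ k₂ : ℝ, 0 < k₁ ∧ 0 < k₂ ∧ ∀ ξ η : GromovBoundary d o,
    k₁ * negPow r (boundaryProduct d o ξ η) ≤ m.dist ξ η ∧
      m.dist ξ η ≤ k₂ * negPow r (boundaryProduct d o ξ η)

/-- The rule `lim a_n ↦ lim f(a_n)` is well defined as a map `∂Y → ∂X`: the image of a sequence
representing a boundary point represents a boundary point, and sequences representing the same
point have images representing the same point. -/
def InducedMapWellDefined {Y X : Type*} (dY : Y → Y → ℝ) (oY : Y) (dX : X → X → ℝ) (oX : X)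
    (f : Y → X) : Prop :=
  (∀ a : SeqToInfinity dY oY, JointlyDiverge dX oX (f ∘ a.1) (f ∘ a.1)) ∧
    ∀ a b : SeqToInfinity dY oY, SeqEquiv dY oY a b → JointlyDiverge dX oX (f ∘ a.1) (f ∘ b.1)

/-- The map `∂Y → ∂X` induced by `f`, sending `lim a_n` to `lim f(a_n)`. -/
def inducedMap {Y X : Type*} {dY : Y → Y → ℝ} {oY : Y} {dX : X → X → ℝ} {oX : X} {f : Y → X}
    (hf : InducedMapWellDefined dY oY dX oX f) : GromovBoundary dY oY → GromovBoundary dX oX :=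
  Quot.map (fun a => ⟨f ∘ a.1, hf.1 a⟩) fun a b hab => hf.2 a b hab

end Boundary

/-- The modulus of continuity `ε(δ) = sup {d(f a, f b) | d(a, b) ≤ δ} ∈ [0, ∞]`. -/
noncomputable def modulusOfContinuity {U V : Type*} (mU : MetricSpace U) (mV : MetricSpace V)
    (f : U → V) (δ : ℝ) : ℝ≥0∞ :=
  ⨆ (a : U) (b : U) (_ : mU.dist a b ≤ δ), ENNReal.ofReal (mV.dist (f a) (f b))

section Groups

/-- The word metric of a generating set `S`: the path metric on the vertices of the Cayley graph,
i.e. `wordDist S g h` is the least length of a word on `S ∪ S⁻¹` representing `g⁻¹ h`. -/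
noncomputable def wordDist {G : Type*} [Group G] (S : Set G) (g h : G) : ℕ :=
  (SimpleGraph.mulCayley S).dist g h

/-- The word metric as a real-valued distance. -/
noncomputable def wordMetric {G : Type*} [Group G] (S : Set G) (g h : G) : ℝ :=
  (wordDist S g h : ℝ)

/-- The distortion function `Dist(n) = max {d_Λ(e, h) | h ∈ Λ, d_Γ(e, h) ≤ n}` for word metrics of
generating sets `B` of `Λ` and `A` of `Γ`. When `A` is finite, the balls of `Γ` are finite and the
supremum is a maximum. -/
noncomputable def distortion {Γ : Type*} [Group Γ] (Λ : Subgroup Γ) (A : Set Γ) (B : Set Λ)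
    (n : ℕ) : ℕ :=
  sSup {k : ℕ | ∃ h : Λ, wordDist A 1 (h : Γ) ≤ n ∧ k = wordDist B 1 h}

/-- A (hyperbolic) group is non-elementary when it contains a free subgroup of rank two. -/
def NonElementary (G : Type*) [Group G] : Prop :=
  ∃ φ : FreeGroup (Fin 2) →* G, Function.Injective φ

end Groups

end CannonThurston

open CannonThurston

namespace CannonThurston

/-! Take three sequences in `Λ` whose images in `∂Γ` are pairwise distinct, and let `h` realise the
distortion at `n`. Seen from `h⁻¹ * o`, at least two of the three limit points lie behind `o`
(`exists_pair_le_gromovProduct`). Translating these two by `h` gives boundary points of `Λ` with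
product at least `Dist(n) - C₂`. In `Γ` the same translation raises the product of the images by at
most the displacement of `p`, which is `n` up to a constant, so the images stay `α / s ^ n` apart.

The harder point is `exists_three_separated`. If it failed, then among `ξ`, `gξ`, `g²ξ` two would
have the same image, so every square in `Λ` would fix the image of `ξ`. By
`finite_commutators_of_fix`, the elements fixing a point of `∂Γ` have finitely many commutators: two
products `gh` and `hg` send a point far along a geodesic towards the fixed point to within `14δ` of
each other. But squares in a free group of rank two have infinitely many commutators
(`freeGroup_conj_injective`). -/

/-- A symmetric distance function satisfying the triangle inequality and vanishing on the
diagonal. -/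
structure IsPseudoDist {X : Type*} (d : X → X → ℝ) : Prop where
  self : ∀ x, d x x = 0
  comm : ∀ x y, d x y = d y x
  triangle : ∀ x y z, d x z ≤ d x y + d y z

/-! ### Word metrics: invariance, geodesics, finite balls. -/

section WordMetric

variable {G : Type*} [Group G] {S : Set G}

theorem mulCayley_connected (hS : Subgroup.closure S = ⊤) :
    (SimpleGraph.mulCayley S).Connected := by
  have hadj : ∀ x s : G, s ∈ S → (SimpleGraph.mulCayley S).Reachable x (x * s) := by
    intro x s hs
    by_cases h : x = x * s
    · rw [← h]
    · exact SimpleGraph.Adj.reachable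
        ((SimpleGraph.mulCayley_adj S _ _).2 ⟨h, Or.inl (by simpa using hs)⟩)
  have key : ∀ g : G, (SimpleGraph.mulCayley S).Reachable 1 g := by
    intro g
    have hg : g ∈ Subgroup.closure S := by rw [hS]; trivial
    induction hg using Subgroup.closure_induction_right with
    | one => exact SimpleGraph.Reachable.refl _
    | mul_right x _ s hs ih => exact ih.trans (hadj x s hs)
    | mul_inv_cancel x _ s hs ih =>
      refine ih.trans ?_
      simpa using (hadj (x * s⁻¹) s hs).symm
  have : Nonempty G := ⟨1⟩
  exact ⟨fun x y => (key x).symm.trans (key y)⟩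

theorem wordDist_mul_left_le (hS : Subgroup.closure S = ⊤) (g x y : G) :
    wordDist S (g * x) (g * y) ≤ wordDist S x y := by
  obtain ⟨w, hw⟩ := (mulCayley_connected hS).exists_walk_length_eq_dist x y
  let f : SimpleGraph.mulCayley S →g SimpleGraph.mulCayley S :=
    ⟨fun z => g * z, fun h => SimpleGraph.mulCayley_adj_mul_iff_right.2 h⟩
  have := SimpleGraph.dist_le (w.map f)
  rw [SimpleGraph.Walk.length_map, hw] at this
  exact this

theorem wordMetric_mul_left (hS : Subgroup.closure S = ⊤) (g x y : G) :
    wordMetric S (g * x) (g * y) = wordMetric S x y := by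
  refine congrArg Nat.cast (le_antisymm (wordDist_mul_left_le hS g x y) ?_)
  simpa using wordDist_mul_left_le hS g⁻¹ (g * x) (g * y)

theorem wordMetric_isPseudoDist (hS : Subgroup.closure S = ⊤) : IsPseudoDist (wordMetric S) where
  self x := by simp [wordMetric, wordDist]
  comm x y := congrArg Nat.cast SimpleGraph.dist_comm
  triangle x y z := by
    unfold wordMetric
    exact_mod_cast (mulCayley_connected hS).dist_triangle (u := x) (v := y) (w := z)

/-- Points on a geodesic from `x` to `y` in the Cayley graph. -/
theorem exists_wordDist_eq (hS : Subgroup.closure S = ⊤) (x y : G) {k : ℕ}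
    (hk : k ≤ wordDist S x y) :
    ∃ z, wordDist S x z = k ∧ k + wordDist S z y = wordDist S x y := by
  obtain ⟨w, hw⟩ := (mulCayley_connected hS).exists_walk_length_eq_dist x y
  have h1 := SimpleGraph.dist_le (w.take k)
  have h2 := SimpleGraph.dist_le (w.drop k)
  have h3 := (mulCayley_connected hS).dist_triangle (u := x) (v := w.getVert k) (w := y)
  rw [SimpleGraph.Walk.take_length] at h1
  rw [SimpleGraph.Walk.drop_length] at h2
  refine ⟨w.getVert k, ?_⟩
  unfold wordDist at *
  omega

theorem finite_wordDist_le (hS : Subgroup.closure S = ⊤) (hfin : S.Finite) (n : ℕ) :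
    {g : G | wordDist S 1 g ≤ n}.Finite := by
  induction n with
  | zero =>
    refine (Set.finite_singleton (1 : G)).subset fun g hg => ?_
    have : wordDist S 1 g = 0 := by simpa using hg
    exact ((mulCayley_connected hS).dist_eq_zero_iff.1 this).symm
  | succ n ih =>
    refine (ih.union (Set.Finite.image2 (fun x y => x * y) ih
      (hfin.union hfin.inv))).subset fun g hg => ?_
    rcases Nat.lt_or_ge n (wordDist S 1 g) with h | h
    · right
      obtain ⟨z, hz1, hz2⟩ := exists_wordDist_eq hS 1 g h.le
      have hg' : wordDist S 1 g ≤ n + 1 := hg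
      have h1 : wordDist S z g = 1 := by omega
      have h2 := (SimpleGraph.mulCayley_adj S _ _).1 (SimpleGraph.dist_eq_one_iff_adj.1 h1)
      refine ⟨z, hz1.le, z⁻¹ * g, ?_, by simp⟩
      rcases h2.2 with h | h
      · exact Or.inl h
      · exact Or.inr (by simpa using h)
    · exact Or.inl h

end WordMetric

/-! ### Four-point inequalities. -/

section Hyperbolic

variable {X : Type*} {d : X → X → ℝ} {δ : ℝ}

theorem IsPseudoDist.nonneg (hd : IsPseudoDist d) (x y : X) : 0 ≤ d x y := by
  have := hd.triangle x y x
  rw [hd.self, hd.comm y x] at this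
  linarith

theorem gromovProduct_comm (hd : IsPseudoDist d) (o x y : X) :
    gromovProduct d o x y = gromovProduct d o y x := by
  unfold gromovProduct; rw [hd.comm x y]; ring

theorem gromovProduct_le_add (hd : IsPseudoDist d) (o p x y : X) :
    gromovProduct d o x y ≤ gromovProduct d p x y + d p o := by
  unfold gromovProduct
  have h1 := hd.triangle x p o
  have h2 := hd.triangle y p o
  linarith

/-- The four point condition. -/
theorem four_point (hδ : ∀ o x y z : X,
      min (gromovProduct d o x z) (gromovProduct d o y z) - δ ≤ gromovProduct d o x y)
    (x y z w : X) :
    d x y + d z w ≤ max (d x z + d y w) (d x w + d y z) + 2 * δ := by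
  have h := hδ w x y z
  unfold gromovProduct at h
  rcases min_choice ((d x w + d z w - d x z) / 2) ((d y w + d z w - d y z) / 2) with h' | h' <;>
    rw [h'] at h
  · have := le_max_left (d x z + d y w) (d x w + d y z)
    linarith
  · have := le_max_right (d x z + d y w) (d x w + d y z)
    linarith

/-- Distances to two points that lie far away in the same direction have almost the same
increments. -/
theorem busemann_increment_le (hd : IsPseudoDist d) (hδ : ∀ o x y z : X,
      min (gromovProduct d o x z) (gromovProduct d o y z) - δ ≤ gromovProduct d o x y)
    (p z z' c c' : X) (h : d z p + d z' p ≤ gromovProduct d p c c') :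
    d z c + d z' c' ≤ d z c' + d z' c + 2 * δ := by
  have h4 := four_point hδ z c z' c'
  unfold gromovProduct at h
  have h1 := hd.triangle z p z'
  have h2 := hd.triangle c z' p
  have h3 := hd.triangle c' z p
  have h5 := hd.comm p z'
  have h6 := hd.comm c' z
  have h7 := hd.comm c z'
  rcases max_choice (d z z' + d c c') (d z c' + d c z') with h' | h' <;> rw [h'] at h4 <;> linarith

end Hyperbolic

/-! ### Displacement by elements almost fixing a direction. -/

section Commutator

variable {G : Type*} [Group G] {d : G → G → ℝ} {δ : ℝ}

/-- If `c` lies far away in a direction that is almost fixed by `g`, then `g` moves points of a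
geodesic from `p` to `c` close to that geodesic. -/
theorem dist_translate_add_le (hd : IsPseudoDist d) (hδ : ∀ o x y z : G,
      min (gromovProduct d o x z) (gromovProduct d o y z) - δ ≤ gromovProduct d o x y)
    (hinv : ∀ g x y : G, d (g * x) (g * y) = d x y) {p y c g : G}
    (hy : d p y + d y c = d p c) (hg : d (g * p) p ≤ d p y)
    (hc : d p y + d (g * p) p ≤ gromovProduct d p c (g * c)) :
    d (g * y) p + d (g * y) c ≤ d p c + 4 * δ := by
  have e1 : d (g * y) p = d y (g⁻¹ * p) := by rw [← hinv g⁻¹ (g * y) p]; simp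
  have e2 : d p (g * c) = d (g⁻¹ * p) c := by rw [← hinv g⁻¹ p (g * c)]; simp
  have e3 : d (g * p) p = d p (g⁻¹ * p) := by rw [← hinv g⁻¹ (g * p) p]; simp
  have t1 : d (g * y) p ≤ d p y + d (g * p) p := by
    have := hd.triangle (g * y) (g * p) p
    rw [hinv, hd.comm y p] at this; exact this
  have hb := busemann_increment_le hd hδ p (g * y) p c (g * c) (by rw [hd.self]; linarith)
  rw [hinv, e2] at hb
  have h4 := four_point hδ y (g⁻¹ * p) p c
  have t2 := hd.triangle p (g⁻¹ * p) c
  have c1 := hd.comm y p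
  have c2 := hd.comm (g⁻¹ * p) p
  -- In the first case the terms in `d (g⁻¹ * p) c` cancel; the second is where `hg` is needed.
  rcases max_choice (d y p + d (g⁻¹ * p) c) (d y c + d (g⁻¹ * p) p) with h' | h' <;>
    rw [h'] at h4 <;> linarith

/-- Commutators of elements that almost fix the direction of `c` move the points of a geodesic from
`p` to `c` by a bounded amount. -/
theorem commutator_displacement_le (hd : IsPseudoDist d) (hδ : ∀ o x y z : G,
      min (gromovProduct d o x z) (gromovProduct d o y z) - δ ≤ gromovProduct d o x y)
    (hinv : ∀ g x y : G, d (g * x) (g * y) = d x y) {p y c g h : G} {L R : ℝ}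
    (hy : d p y + d y c = d p c) (hgL : d (g * p) p ≤ L) (hhL : d (h * p) p ≤ L)
    (hL : 2 * L ≤ d p y) (hR : d p y + 3 * L ≤ R)
    (hgc : R ≤ gromovProduct d p c (g * c)) (hhc : R ≤ gromovProduct d p c (h * c))
    (hghc : R ≤ gromovProduct d p c (g * h * c)) (hhgc : R ≤ gromovProduct d p c (h * g * c)) :
    d (g * h * y) (h * g * y) ≤ 14 * δ := by
  have hL0 : 0 ≤ L := (hd.nonneg _ _).trans hgL
  have tri : ∀ u z : G, d (u * z) p ≤ d z p + d (u * p) p := fun u z => by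
    have := hd.triangle (u * z) (u * p) p
    rwa [hinv] at this
  -- Busemann cocycle: `u` changes the distance to `c` by an amount almost independent of `z`.
  -- Applied to `g` and `h` in either order, it puts `g * h * y` and `h * g * y` at the same
  -- distance from `c` up to `8δ`. The `3 * L` in `hR` covers the case where `z` is itself a
  -- translate of `y`.
  have key : ∀ u z : G, d (u * p) p ≤ L → R ≤ gromovProduct d p c (u * c) →
      d z p ≤ d p y + L → |d (u * z) c - d z c - (d (u * p) c - d p c)| ≤ 2 * δ := by
    intro u z hu huc hz
    have t := tri u z
    have h1 := busemann_increment_le hd hδ p (u * z) (u * p) c (u * c) (by linarith)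
    have h2 := busemann_increment_le hd hδ p (u * p) (u * z) c (u * c) (by linarith)
    rw [hinv, hinv] at h1 h2
    rw [abs_le]; constructor <;> linarith
  have cy := hd.comm y p
  have tg := tri g y
  have th := tri h y
  have k1 := abs_le.1 (key h y hhL hhc (by linarith))
  have k2 := abs_le.1 (key g (h * y) hgL hgc (by linarith))
  have k3 := abs_le.1 (key g y hgL hgc (by linarith))
  have k4 := abs_le.1 (key h (g * y) hhL hhc (by linarith))
  rw [← mul_assoc] at k2 k4
  have tgh := tri g (h * p)
  have thg := tri h (g * p)
  rw [← mul_assoc] at tgh thg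
  -- Both points also lie near a geodesic from `p` to `c`, so almost equal distances to `c` force
  -- them to be close.
  have n1 := dist_translate_add_le hd hδ hinv (g := g * h) hy (by linarith) (by linarith)
  have n2 := dist_translate_add_le hd hδ hinv (g := h * g) hy (by linarith) (by linarith)
  have h4 := four_point hδ (g * h * y) (h * g * y) p c
  rcases max_choice (d (g * h * y) p + d (h * g * y) c) (d (g * h * y) c + d (h * g * y) p)
    with h' | h' <;> rw [h'] at h4 <;> linarith

end Commutator

/-! ### Sequences tending to infinity: equivalence, base points, translation. -/

section JointlyDiverge

variable {X : Type*} {d : X → X → ℝ} {o : X} {a b c : ℕ → X}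

theorem JointlyDiverge.symm (hd : IsPseudoDist d) (h : JointlyDiverge d o a b) :
    JointlyDiverge d o b a := by
  have hsw : Tendsto (Prod.swap : ℕ × ℕ → ℕ × ℕ) atTop atTop := by
    rw [← prod_atTop_atTop_eq]; exact tendsto_snd.prodMk tendsto_fst
  exact (h.comp hsw).congr fun q => gromovProduct_comm hd _ _ _

theorem JointlyDiverge.trans (hd : IsPseudoDist d) (hh : IsGromovHyperbolic d)
    (ha : JointlyDiverge d o a a) (hb : JointlyDiverge d o b b) (hc : JointlyDiverge d o c c)
    (hab : JointlyDiverge d o a b) (hbc : JointlyDiverge d o b c) : JointlyDiverge d o a c :=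
  (seqEquiv_equivalence o hd.comm hh).trans (x := ⟨a, ha⟩) (y := ⟨b, hb⟩) (z := ⟨c, hc⟩) hab hbc

theorem JointlyDiverge.change_base (hd : IsPseudoDist d) (o' : X) (h : JointlyDiverge d o a b) :
    JointlyDiverge d o' a b :=
  tendsto_atTop_mono (fun q => by
    have := gromovProduct_le_add hd o o' (a q.1) (b q.2)
    linarith) (tendsto_atTop_add_const_right _ (-d o' o) h)

theorem JointlyDiverge.eventually_le (h : JointlyDiverge d o a b) (R : ℝ) :
    ∀ᶠ n in atTop, R ≤ gromovProduct d o (a n) (b n) :=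
  tendsto_atTop_diagonal.eventually (tendsto_atTop.1 h R)

theorem gromovProduct_mul_left {G : Type*} [Group G] {d : G → G → ℝ}
    (hinv : ∀ g x y : G, d (g * x) (g * y) = d x y) (g o x y : G) :
    gromovProduct d (g * o) (g * x) (g * y) = gromovProduct d o x y := by
  simp only [gromovProduct, hinv]

theorem JointlyDiverge.mul_left {G : Type*} [Group G] {d : G → G → ℝ} (hd : IsPseudoDist d)
    (hinv : ∀ g x y : G, d (g * x) (g * y) = d x y) {o : G} {a b : ℕ → G} (g : G)
    (h : JointlyDiverge d o a b) :
    JointlyDiverge d o (fun n => g * a n) (fun n => g * b n) :=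
  JointlyDiverge.change_base hd o (o := g * o)
    (Tendsto.congr (fun q => (gromovProduct_mul_left hinv g o (a q.1) (b q.2)).symm) h)

/-- In a hyperbolic space, inequivalent sequences tending to infinity have eventually bounded
Gromov products. -/
theorem exists_gromovProduct_le_of_not_jointlyDiverge (hd : IsPseudoDist d)
    (hh : IsGromovHyperbolic d) (ha : JointlyDiverge d o a a) (hb : JointlyDiverge d o b b)
    (hab : ¬ JointlyDiverge d o a b) :
    ∃ M : ℝ, ∃ N : ℕ, ∀ m ≥ N, ∀ n ≥ N, gromovProduct d o (a m) (b n) ≤ M := by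
  obtain ⟨δ, hδ0, hδ⟩ := hh
  unfold JointlyDiverge at hab
  rw [tendsto_atTop] at hab
  push Not at hab
  obtain ⟨M, hM⟩ := hab
  obtain ⟨q, hq⟩ := eventually_atTop.1 (tendsto_atTop.1 ha (M + 2 * δ))
  obtain ⟨q', hq'⟩ := eventually_atTop.1 (tendsto_atTop.1 hb (M + 2 * δ))
  set N := max (max q.1 q.2) (max q'.1 q'.2)
  refine ⟨M + 2 * δ, N, fun m hm n hn => ?_⟩
  obtain ⟨t, ht, htM⟩ := (frequently_atTop.1 hM) (N, N)
  have hm1 := hq (t.1, m) ⟨by have := ht.1; simp only at *; omega, by simp only; omega⟩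
  have hn1 := hq' (t.2, n) ⟨by have := ht.2; simp only at *; omega, by simp only; omega⟩
  by_contra hcon
  push Not at hcon
  have h1 := hδ o (a t.1) (b n) (a m)
  have h2 := hδ o (a t.1) (b t.2) (b n)
  rw [gromovProduct_comm hd o (b n) (a m)] at h1
  have h3 := le_min hm1 hcon.le
  simp only at h3 hn1
  have h4 := le_min (show M + δ ≤ gromovProduct d o (a t.1) (b n) by linarith)
    (show M + δ ≤ gromovProduct d o (b t.2) (b n) by linarith)
  linarith

end JointlyDiverge

/-! ### Commutators in the stabiliser of a boundary point. -/

section Stabilizer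

variable {G : Type*} [Group G] {S : Set G}

/-- The elements fixing a boundary point of a hyperbolic group have only finitely many
commutators. -/
theorem finite_commutators_of_fix (hS : Subgroup.closure S = ⊤) (hfin : S.Finite)
    (hh : IsGromovHyperbolic (wordMetric S)) {p : G} {c : ℕ → G}
    (hc : JointlyDiverge (wordMetric S) p c c) :
    {x : G | ∃ g h : G, JointlyDiverge (wordMetric S) p c (fun n => g * c n) ∧
      JointlyDiverge (wordMetric S) p c (fun n => h * c n) ∧ x = (h * g)⁻¹ * (g * h)}.Finite := by
  have hd := wordMetric_isPseudoDist hS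
  have hinv := wordMetric_mul_left hS
  have hmul : ∀ g h : G, JointlyDiverge (wordMetric S) p c (fun n => g * c n) →
      JointlyDiverge (wordMetric S) p c (fun n => h * c n) →
      JointlyDiverge (wordMetric S) p c (fun n => g * h * c n) := by
    intro g h hg hgh
    have h1 := hgh.mul_left hd hinv g
    simp only [← mul_assoc] at h1
    exact hc.trans hd hh (hc.mul_left hd hinv g) (hc.mul_left hd hinv (g * h)) hg h1
  have hh' := hh
  obtain ⟨δ, hδ0, hδ⟩ := hh'
  by_contra hinf
  obtain ⟨D, hD⟩ := exists_nat_ge (14 * δ)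
  have hball := finite_wordDist_le hS hfin D
  -- Pigeonhole: with one point `y` serving all of `t`, conjugation by `y` will embed `t` in a ball
  -- with fewer elements.
  obtain ⟨t, hts, htc⟩ := Set.Infinite.exists_subset_card_eq hinf (hball.toFinset.card + 1)
  choose! g h hg hh₁ hx using fun x (hx : x ∈ t) => hts hx
  obtain ⟨L, hL⟩ := (((eventually_all_finset t).2 fun x _ =>
    (eventually_ge_atTop (wordMetric S (g x * p) p))).and ((eventually_all_finset t).2 fun x _ =>
    (eventually_ge_atTop (wordMetric S (h x * p) p)))).exists
  obtain ⟨T, hT⟩ := exists_nat_ge (2 * L)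
  obtain ⟨n, hn0, hn⟩ := ((hc.eventually_le T).and ((eventually_all_finset t).2 fun x hx =>
    ((hg x hx).eventually_le (T + 3 * L)).and (((hh₁ x hx).eventually_le (T + 3 * L)).and
    (((hmul _ _ (hg x hx) (hh₁ x hx)).eventually_le (T + 3 * L)).and
    ((hmul _ _ (hh₁ x hx) (hg x hx)).eventually_le (T + 3 * L)))))).exists
  -- The product of `c n` with itself is its distance from `p`, so a geodesic to `c n` is long
  -- enough to contain `y`.
  have hTc : T ≤ wordDist S p (c n) := by
    have : (T : ℝ) ≤ wordMetric S p (c n) := by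
      unfold gromovProduct at hn0
      rw [hd.self, hd.comm (c n) p] at hn0
      linarith
    unfold wordMetric at this
    exact_mod_cast this
  obtain ⟨y, hy1, hy2⟩ := exists_wordDist_eq hS p (c n) hTc
  have hy1' : wordMetric S p y = T := by unfold wordMetric; exact_mod_cast hy1
  have hy2' : wordMetric S p y + wordMetric S y (c n) = wordMetric S p (c n) := by
    rw [hy1']; unfold wordMetric; exact_mod_cast hy2
  have hmaps : ∀ x ∈ t, y⁻¹ * x * y ∈ hball.toFinset := by
    intro x hxt
    obtain ⟨r1, r2, r3, r4⟩ := hn x hxt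
    have := commutator_displacement_le hd hδ hinv hy2' (hL.1 x hxt) (hL.2 x hxt)
      (by rw [hy1']; exact hT) (by rw [hy1']) r1 r2 r3 r4
    rw [← hinv (h x * g x * y)⁻¹, inv_mul_cancel, hd.comm] at this
    have e : (h x * g x * y)⁻¹ * (g x * h x * y) = y⁻¹ * x * y := by
      conv_rhs => rw [hx x hxt]
      group
    rw [e] at this
    have h3 := this.trans hD
    simpa [wordMetric] using h3
  have := Finset.card_le_card_of_injOn (fun x => y⁻¹ * x * y) hmaps
    (fun x _ x' _ hxx => by simpa using hxx)
  omega

end Stabilizer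

/-! ### Infinitely many conjugates in a free group. -/

section FreeGroup

/-- Under a homomorphism to `SL(2, ℤ)` the `k`-th conjugate acquires upper left entry `1 - 2k`. The
homomorphism need not be injective. -/
theorem freeGroup_conj_injective :
    Function.Injective fun k : ℕ => ((FreeGroup.of (1 : Fin 2)) ^ k)⁻¹ *
      (FreeGroup.of (0 : Fin 2)) ^ 2 * (FreeGroup.of (1 : Fin 2)) ^ k := by
  intro k l hkl
  let U : Matrix.SpecialLinearGroup (Fin 2) ℤ := ⟨!![1, 0; 1, 1], by simp⟩
  have hU : (U ^ 2).1 = !![1, 0; 2, 1] := by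
    rw [Matrix.SpecialLinearGroup.coe_pow, pow_two]; simp [U]
  have hT : ∀ m : ℕ, (ModularGroup.T ^ m).1 = !![1, (m : ℤ); 0, 1] := fun m => by
    simpa using ModularGroup.coe_T_zpow m
  have key := congrArg (FreeGroup.lift ![U, ModularGroup.T]) hkl
  simp only [map_mul, map_pow, map_inv, FreeGroup.lift_apply_of, Matrix.cons_val_zero,
    Matrix.cons_val_one] at key
  have := congrArg (fun M => M.1 0 0) key
  simp [Matrix.SpecialLinearGroup.coe_inv, Matrix.SpecialLinearGroup.coe_mul, hT, hU,
    Matrix.adjugate_fin_two, -Matrix.SpecialLinearGroup.coe_pow] at this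
  exact_mod_cast this

end FreeGroup

/-! ### Geodesic rays and nonempty boundary. -/

section Ray

variable {G : Type*} [Group G] {S : Set G}

theorem exists_geodesic_path (hS : Subgroup.closure S = ⊤) (x y : G) :
    ∃ γ : ℕ → G, γ 0 = x ∧ ∀ m n, m ≤ n → n ≤ wordDist S x y → wordDist S (γ m) (γ n) = n - m := by
  obtain ⟨w, hw⟩ := (mulCayley_connected hS).exists_walk_length_eq_dist x y
  refine ⟨w.getVert, by simp, fun m n hmn hn => ?_⟩
  have h1 := SimpleGraph.dist_le (w.take m)
  have h2 := SimpleGraph.dist_le (w.drop n)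
  have h3 := SimpleGraph.dist_le ((w.drop m).take (n - m))
  have e : (w.drop m).getVert (n - m) = w.getVert n := by
    rw [SimpleGraph.Walk.drop_getVert]; congr 1; omega
  rw [SimpleGraph.Walk.take_length] at h1 h3
  rw [e] at h3
  rw [SimpleGraph.Walk.drop_length] at h2
  have h4 := (mulCayley_connected hS).dist_triangle (u := x) (v := w.getVert m) (w := y)
  have h5 := (mulCayley_connected hS).dist_triangle (u := w.getVert m) (v := w.getVert n) (w := y)
  unfold wordDist at *
  omega

/-- An infinite finitely generated group contains a geodesic ray. -/
theorem exists_geodesic_ray [Infinite G] (hS : Subgroup.closure S = ⊤) (hfin : S.Finite) :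
    ∃ a : ℕ → G, ∀ m n, m ≤ n → wordDist S (a m) (a n) = n - m := by
  choose γ hγ0 hγ using exists_geodesic_path hS (1 : G)
  have hlarge : ∀ k : ℕ, ∀ᶠ g in (hyperfilter G : Filter G), k ≤ wordDist S 1 g := by
    intro k
    have := Set.Finite.compl_mem_hyperfilter (finite_wordDist_le hS hfin k)
    filter_upwards [this] with g hg
    simp only [Set.mem_compl_iff, Set.mem_ofPred_eq] at hg
    omega
  -- Compactness: the `k`-th points of the geodesics from `1` lie in a finite ball for almost every
  -- endpoint, so a nonprincipal ultrafilter on the endpoints selects one of them.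
  have hex : ∀ k : ℕ, ∃ x : G, ∀ᶠ g in (hyperfilter G : Filter G), γ g k = x := by
    intro k
    have h1 : (⋃ x ∈ {x : G | wordDist S 1 x ≤ k}, {g : G | γ g k = x}) ∈ hyperfilter G := by
      filter_upwards [hlarge k] with g hg
      have := hγ g 0 k (Nat.zero_le _) hg
      rw [hγ0] at this
      simp only [Set.mem_iUnion, Set.mem_ofPred_eq]
      exact ⟨γ g k, by omega, rfl⟩
    obtain ⟨x, -, hx⟩ := (Ultrafilter.finite_biUnion_mem_iff (finite_wordDist_le hS hfin k)).1 h1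
    exact ⟨x, hx⟩
  choose a ha using hex
  refine ⟨a, fun m n hmn => ?_⟩
  obtain ⟨g, hg1, hg2, hg3⟩ := ((ha m).and ((ha n).and (hlarge n))).exists
  rw [← hg1, ← hg2]
  exact hγ g m n hmn hg3

theorem exists_seqToInfinity [Infinite G] (hS : Subgroup.closure S = ⊤) (hfin : S.Finite) (o : G) :
    Nonempty (SeqToInfinity (wordMetric S) o) := by
  obtain ⟨a, ha⟩ := exists_geodesic_ray hS hfin
  have hd := wordMetric_isPseudoDist hS
  have key : ∀ q : ℕ × ℕ, ((min q.1 q.2 : ℕ) : ℝ) ≤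
      gromovProduct (wordMetric S) (a 0) (a q.1) (a q.2) := by
    rintro ⟨m, n⟩
    have h0 : ∀ m, wordMetric S (a m) (a 0) = m := fun m => by
      rw [hd.comm]; unfold wordMetric; rw [ha 0 m (Nat.zero_le _)]; simp
    have h1 : ∀ m n, m ≤ n → wordMetric S (a m) (a n) = n - m := fun m n hmn => by
      unfold wordMetric; rw [ha m n hmn]; push_cast [hmn]; ring
    unfold gromovProduct
    simp only [h0]
    rcases le_total m n with h | h
    · rw [min_eq_left h, h1 m n h]; linarith
    · rw [min_eq_right h, hd.comm, h1 n m h]; linarith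
  have hmin : Tendsto (fun q : ℕ × ℕ => ((min q.1 q.2 : ℕ) : ℝ)) atTop atTop := by
    refine tendsto_natCast_atTop_atTop.comp (tendsto_atTop.2 fun M => ?_)
    filter_upwards [eventually_ge_atTop (M, M)] with q hq
    exact le_min hq.1 hq.2
  have h : JointlyDiverge (wordMetric S) (a 0) a a := tendsto_atTop_mono key hmin
  exact ⟨a, h.change_base hd o⟩

end Ray

/-! ### Boundary products and visual metrics. -/

section BoundaryProduct

variable {X : Type*} {d : X → X → ℝ} {o : X} {δ : ℝ}

/-- Replacing either representative by an equivalent one costs one `δ`, which bounds the supremum by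
one pair of sequences. -/
theorem boundaryProduct_lim_le (hd : IsPseudoDist d) (hh : IsGromovHyperbolic d)
    (hδ : ∀ o x y z : X,
      min (gromovProduct d o x z) (gromovProduct d o y z) - δ ≤ gromovProduct d o x y)
    (a b : SeqToInfinity d o) {K : ℝ} {N : ℕ}
    (h : ∀ m ≥ N, ∀ n ≥ N, gromovProduct d o (a.1 m) (b.1 n) ≤ K) :
    boundaryProduct d o (GromovBoundary.lim a) (GromovBoundary.lim b) ≤
      ENNReal.ofReal (K + 2 * δ) := by
  have heq := seqEquiv_equivalence o hd.comm hh
  have hrep : ∀ {u v : SeqToInfinity d o}, GromovBoundary.lim u = GromovBoundary.lim v →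
      JointlyDiverge d o u.1 v.1 := fun {u v} huv =>
    Quotient.exact (s := ⟨SeqEquiv d o, heq⟩) huv
  refine iSup_le fun a' => iSup_le fun b' => iSup_le fun ha => iSup_le fun hb => ?_
  refine liminf_le_of_frequently_le' (Eventually.frequently ?_)
  obtain ⟨q, hq⟩ := eventually_atTop.1 (tendsto_atTop.1 (hrep ha) (K + 2 * δ + 1))
  obtain ⟨q', hq'⟩ := eventually_atTop.1 (tendsto_atTop.1 (hrep hb) (K + 2 * δ + 1))
  filter_upwards [eventually_ge_atTop (q.1, q'.1)] with t ht
  refine ENNReal.ofReal_le_ofReal ?_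
  by_contra! hcon
  have h1 := hq (t.1, max N q.2) ⟨ht.1, le_max_right _ _⟩
  have h2 := hq' (t.2, max N q'.2) ⟨ht.2, le_max_right _ _⟩
  have h3 := h _ (le_max_left N q.2) _ (le_max_left N q'.2)
  simp only at h1 h2
  set x := a.1 (max N q.2)
  set y := b.1 (max N q'.2)
  rw [gromovProduct_comm hd] at h1 h2
  have h4 := hδ o x (b'.1 t.2) (a'.1 t.1)
  rw [gromovProduct_comm hd o (b'.1 t.2) (a'.1 t.1)] at h4
  have h5 := hδ o x y (b'.1 t.2)
  -- Capping the product at `K + 2 * δ + 1` lets one number bound all three products in the chain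
  -- from below.
  obtain ⟨e, he, he1, he2⟩ : ∃ e, K + 2 * δ < e ∧ e ≤ gromovProduct d o (a'.1 t.1) (b'.1 t.2) ∧
      e ≤ K + 2 * δ + 1 :=
    ⟨min (gromovProduct d o (a'.1 t.1) (b'.1 t.2)) (K + 2 * δ + 1), lt_min hcon (by linarith),
      min_le_left _ _, min_le_right _ _⟩
  have h6 := le_min (he2.trans h1) he1
  have hδ0 : 0 ≤ δ := by
    have := hδ o o o o
    rw [min_self] at this
    linarith
  have h7 := le_min (show e - δ ≤ gromovProduct d o x (b'.1 t.2) by linarith)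
    (show e - δ ≤ gromovProduct d o y (b'.1 t.2) by linarith)
  linarith

theorem le_boundaryProduct_lim (a b : SeqToInfinity d o) {K : ℝ} {N : ℕ}
    (h : ∀ m ≥ N, ∀ n ≥ N, K ≤ gromovProduct d o (a.1 m) (b.1 n)) :
    ENNReal.ofReal K ≤
      boundaryProduct d o (GromovBoundary.lim a) (GromovBoundary.lim b) := by
  refine le_trans ?_ (le_iSup₂_of_le a b (le_iSup₂_of_le rfl rfl le_rfl))
  refine le_liminf_of_le (by isBoundedDefault) ?_
  filter_upwards [eventually_ge_atTop (N, N)] with t ht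
  exact ENNReal.ofReal_le_ofReal (h _ ht.1 _ ht.2)

theorem rpow_neg_le_negPow {r K : ℝ} {t : ℝ≥0∞} (hr : 1 < r) (hK : 0 ≤ K)
    (h : t ≤ ENNReal.ofReal K) : r ^ (-K) ≤ negPow r t := by
  have ht : t ≠ ∞ := (h.trans_lt ENNReal.ofReal_lt_top).ne
  rw [negPow, if_neg ht]
  exact Real.rpow_le_rpow_of_exponent_le hr.le (neg_le_neg (ENNReal.toReal_le_of_le_ofReal hK h))

theorem negPow_le_rpow_neg {r K : ℝ} {t : ℝ≥0∞} (hr : 1 < r) (h : ENNReal.ofReal K ≤ t) :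
    negPow r t ≤ r ^ (-K) := by
  rw [negPow]
  split_ifs with ht
  · exact Real.rpow_nonneg (by linarith) _
  · exact Real.rpow_le_rpow_of_exponent_le hr.le
      (neg_le_neg ((ENNReal.ofReal_le_iff_le_toReal ht).1 h))

/-- Among three pairwise separated sequences, two diverge from every given point `q`: seen from
`q`, they lie behind the base point. -/
theorem exists_pair_le_gromovProduct (hd : IsPseudoDist d)
    (hδ : ∀ o x y z : X,
      min (gromovProduct d o x z) (gromovProduct d o y z) - δ ≤ gromovProduct d o x y)
    (a : Fin 3 → ℕ → X) {M : ℝ} {N : ℕ}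
    (h : ∀ i j, i ≠ j → ∀ m ≥ N, ∀ n ≥ N, gromovProduct d o (a i m) (a j n) ≤ M) (q : X) :
    ∃ i j, i ≠ j ∧ ∀ m ≥ N, ∀ n ≥ N,
      d q o - M - 2 * δ ≤ gromovProduct d q (a i m) (a j n) := by
  let P : Fin 3 → Prop := fun i => ∀ m ≥ N, gromovProduct d o (a i m) q ≤ M + δ
  -- Two sequences both pointing towards `q` would have product above `M`, so `P` fails for at most
  -- one index.
  have hP : ∀ i j, i ≠ j → P i ∨ P j := by
    intro i j hij
    by_contra! hcon
    obtain ⟨h1, h2⟩ := hcon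
    simp only [P] at h1 h2
    push Not at h1 h2
    obtain ⟨m, hm, h1⟩ := h1
    obtain ⟨n, hn, h2⟩ := h2
    have h3 := hδ o (a i m) (a j n) q
    have h4 := lt_min h1 h2
    have h5 := h i j hij m hm n hn
    linarith
  have hex : ∃ i j, i ≠ j ∧ P i ∧ P j := by
    have h01 := hP 0 1 (by decide)
    have h02 := hP 0 2 (by decide)
    have h12 := hP 1 2 (by decide)
    by_cases p0 : P 0
    · rcases h12 with p | p
      · exact ⟨0, 1, by decide, p0, p⟩
      · exact ⟨0, 2, by decide, p0, p⟩
    · exact ⟨1, 2, by decide, h01.resolve_left p0, h02.resolve_left p0⟩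
  obtain ⟨i, j, hij, hi, hj⟩ := hex
  refine ⟨i, j, hij, fun m hm n hn => ?_⟩
  -- The products of `x` with `q` based at `o` and with `o` based at `q` add up to `d q o`.
  have key : ∀ x, gromovProduct d o x q ≤ M + δ → d q o - M - δ ≤ gromovProduct d q x o := by
    intro x hx
    unfold gromovProduct at hx ⊢
    rw [hd.comm o q]
    linarith
  have h1 := hδ q (a i m) (a j n) o
  have h2 := le_min (key _ (hi m hm)) (key _ (hj n hn))
  linarith

end BoundaryProduct

/-- The displacement of `q` under `g⁻¹` differs from the word length of `g` by a bounded amount. -/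
theorem displacement_bounds {G : Type*} [Group G] {S : Set G} (hS : Subgroup.closure S = ⊤)
    (g q : G) :
    wordMetric S (g⁻¹ * q) q ≤ wordMetric S 1 g + 2 * wordMetric S 1 q ∧
      wordMetric S 1 g ≤ wordMetric S (g⁻¹ * q) q + 2 * wordMetric S 1 q := by
  have hd := wordMetric_isPseudoDist hS
  have e1 : wordMetric S (g⁻¹ * q) q = wordMetric S q (g * q) := by
    rw [← wordMetric_mul_left hS g]; simp
  have e2 : wordMetric S g (g * q) = wordMetric S 1 q := by
    have := wordMetric_mul_left hS g 1 q
    rwa [mul_one] at this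
  have t1 := hd.triangle q 1 (g * q)
  have t2 := hd.triangle 1 g (g * q)
  have t3 := hd.triangle 1 q (g * q)
  have t4 := hd.triangle 1 (g * q) g
  have c1 := hd.comm q 1
  have c2 := hd.comm (g * q) g
  constructor <;> linarith

/-- The translate of a sequence tending to infinity. -/
def SeqToInfinity.translate {G : Type*} [Group G] {S : Set G} (hS : Subgroup.closure S = ⊤) {o : G}
    (g : G) (a : SeqToInfinity (wordMetric S) o) : SeqToInfinity (wordMetric S) o :=
  ⟨fun n => g * a.1 n, a.2.mul_left (wordMetric_isPseudoDist hS) (wordMetric_mul_left hS) g⟩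

/-! ### Three distinct image points; attaining the distortion. -/

section Subgroup

variable {Γ : Type*} [Group Γ] {Λ : Subgroup Γ} {A : Set Γ} {B : Set Λ}

/-- The image of the Cannon–Thurston map of a non-elementary subgroup has at least three points. -/
theorem exists_three_separated (hAfin : A.Finite) (hA : Subgroup.closure A = ⊤)
    (hBfin : B.Finite) (hB : Subgroup.closure B = ⊤) (hΓ : IsGromovHyperbolic (wordMetric A))
    (hne : NonElementary Λ) {o : Λ} {p : Γ}
    (hCT : InducedMapWellDefined (wordMetric B) o (wordMetric A) p (fun h : Λ => (h : Γ))) :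
    ∃ a : Fin 3 → SeqToInfinity (wordMetric B) o, ∀ i j, i ≠ j →
      ¬ JointlyDiverge (wordMetric A) p (fun n => ((a i).1 n : Γ)) (fun n => ((a j).1 n : Γ)) := by
  by_contra! hcon
  obtain ⟨φ, hφ⟩ := hne
  have : Infinite Λ := Infinite.of_injective φ hφ
  have hd := wordMetric_isPseudoDist hA
  have hinv := wordMetric_mul_left hA
  obtain ⟨ξ⟩ := exists_seqToInfinity hB hBfin o
  let c : ℕ → Γ := fun n => (ξ.1 n : Γ)
  have hc : JointlyDiverge (wordMetric A) p c c := hCT.1 ξ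
  have hsq : ∀ g : Λ, JointlyDiverge (wordMetric A) p c (fun n => ((g ^ 2 : Λ) : Γ) * c n) := by
    intro g
    have h1 : JointlyDiverge (wordMetric A) p c (fun n => (g : Γ) * c n) →
        JointlyDiverge (wordMetric A) p c (fun n => ((g ^ 2 : Λ) : Γ) * c n) := by
      intro h
      have h' := h.mul_left hd hinv (g : Γ)
      simp only [← mul_assoc] at h'
      have e : (g : Γ) * g = ((g ^ 2 : Λ) : Γ) := by push_cast; rw [pow_two]
      rw [e] at h'
      exact hc.trans hd hΓ (hc.mul_left hd hinv _) (hc.mul_left hd hinv _) h h'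
    have h2 : JointlyDiverge (wordMetric A) p (fun n => (g : Γ) * c n)
        (fun n => ((g ^ 2 : Λ) : Γ) * c n) →
        JointlyDiverge (wordMetric A) p c (fun n => ((g ^ 2 : Λ) : Γ) * c n) := by
      intro h
      have h' := h.mul_left hd hinv (g : Γ)⁻¹
      have e : (g : Γ)⁻¹ * ((g ^ 2 : Λ) : Γ) = g := by push_cast; group
      simp only [← mul_assoc, e] at h'
      simp only [inv_mul_cancel, one_mul] at h'
      exact h1 h'
    -- Whichever two of `ξ`, `gξ`, `g²ξ` have the same image, `g²` fixes the image of `ξ`.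
    obtain ⟨i, j, hij, h⟩ := hcon ![ξ, ξ.translate hB g, ξ.translate hB (g ^ 2)]
    fin_cases i <;> fin_cases j
    · exact absurd rfl hij
    · exact h1 h
    · exact h
    · exact h1 (h.symm hd)
    · exact absurd rfl hij
    · exact h2 h
    · exact h.symm hd
    · exact h2 (h.symm hd)
    · exact absurd rfl hij
  set α : FreeGroup (Fin 2) := FreeGroup.of 0
  set β : FreeGroup (Fin 2) := FreeGroup.of 1
  have hfinite := finite_commutators_of_fix hA hAfin hΓ hc
  -- The commutator of two squares: a fixed factor times a conjugate of `φ (α ^ 2)` by a power of `φ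
  -- β`.
  let F : ℕ → Γ := fun k => ((((φ (β ^ k)) ^ 2 : Λ) : Γ) * ((φ α ^ 2 : Λ) : Γ))⁻¹ *
    (((φ α ^ 2 : Λ) : Γ) * (((φ (β ^ k)) ^ 2 : Λ) : Γ))
  have hF : Function.Injective F := by
    intro k l hkl
    have h1 : ∀ k, F k = (((φ (α ^ 2))⁻¹ : Λ) : Γ) *
        ((φ ((β ^ (2 * k))⁻¹ * α ^ 2 * β ^ (2 * k)) : Λ) : Γ) := by
      intro k
      simp only [F]
      norm_cast
      simp only [map_mul, map_inv, map_pow, ← pow_mul]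
      rw [mul_comm k 2]
      group
    rw [h1, h1, mul_right_inj] at hkl
    have := freeGroup_conj_injective (hφ (Subtype.val_injective hkl))
    omega
  refine Set.infinite_range_of_injective hF (hfinite.subset ?_)
  rintro _ ⟨k, rfl⟩
  exact ⟨_, _, hsq _, hsq _, rfl⟩

theorem exists_eq_distortion (hAfin : A.Finite) (hA : Subgroup.closure A = ⊤) (n : ℕ) :
    ∃ h : Λ, wordDist A 1 (h : Γ) ≤ n ∧ distortion Λ A B n = wordDist B 1 h := by
  have hfin : {h : Λ | wordDist A 1 (h : Γ) ≤ n}.Finite :=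
    (finite_wordDist_le hA hAfin n).preimage Subtype.val_injective.injOn
  -- A supremum in `ℕ` is attained once the set is nonempty (take `h = 1`) and bounded (finite
  -- balls).
  refine Nat.sSup_mem (s := {k : ℕ | ∃ h : Λ, wordDist A 1 (h : Γ) ≤ n ∧ k = wordDist B 1 h})
    ⟨_, 1, by simp [wordDist], rfl⟩ (((hfin.image (wordDist B 1)).subset ?_).bddAbove)
  rintro k ⟨h, hh, rfl⟩
  exact ⟨h, hh, rfl⟩

end Subgroup

end CannonThurston

/-! ### The distortion estimate. -/

theorem theorem1p2 {Γ : Type*} [Group Γ] (Λ : Subgroup Γ)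
    (A : Set Γ) (hAfin : A.Finite) (hA : Subgroup.closure A = ⊤)
    (B : Set Λ) (hBfin : B.Finite) (hB : Subgroup.closure B = ⊤)
    (hΓ : IsGromovHyperbolic (wordMetric A)) (hΛ : IsGromovHyperbolic (wordMetric B))
    (hne : NonElementary Λ)
    (o : Λ) (p : Γ)
    (hCT : InducedMapWellDefined (wordMetric B) o (wordMetric A) p (fun h : Λ => (h : Γ)))
    (r s : ℝ)
    (mΛ : MetricSpace (GromovBoundary (wordMetric B) o)) (hmΛ : IsVisualMetric _ o r mΛ)
    (mΓ : MetricSpace (GromovBoundary (wordMetric A) p)) (hmΓ : IsVisualMetric _ p s mΓ) :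
    ∃ α β : ℝ, 0 < α ∧ 0 < β ∧ ∀ n : ℕ,
      ENNReal.ofReal (α / s ^ n) ≤
        modulusOfContinuity mΛ mΓ (inducedMap hCT) (β / r ^ distortion Λ A B n) := by
  have hdA := wordMetric_isPseudoDist hA
  have hdB := wordMetric_isPseudoDist hB
  obtain ⟨a, ha⟩ := exists_three_separated hAfin hA hBfin hB hΓ hne hCT
  obtain ⟨hr, _, k₂, -, hk₂, hvΛ⟩ := hmΛ
  obtain ⟨hs, k₁, _, hk₁, -, hvΓ⟩ := hmΓ
  have hexΓ : ∀ i j, ∃ M : ℝ, ∃ N : ℕ, i ≠ j → ∀ m ≥ N, ∀ n ≥ N,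
      gromovProduct (wordMetric A) p ((a i).1 m : Γ) ((a j).1 n : Γ) ≤ M := by
    intro i j
    by_cases hij : i = j
    · exact ⟨0, 0, fun h => absurd hij h⟩
    · obtain ⟨M, N, h⟩ := exists_gromovProduct_le_of_not_jointlyDiverge hdA hΓ (hCT.1 (a i))
        (hCT.1 (a j)) (ha i j hij)
      exact ⟨M, N, fun _ => h⟩
  -- Separation in `∂Γ` implies separation in `∂Λ`, since `hCT` preserves equivalence.
  have hexΛ : ∀ i j, ∃ M : ℝ, ∃ N : ℕ, i ≠ j → ∀ m ≥ N, ∀ n ≥ N,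
      gromovProduct (wordMetric B) o ((a i).1 m) ((a j).1 n) ≤ M := by
    intro i j
    by_cases hij : i = j
    · exact ⟨0, 0, fun h => absurd hij h⟩
    · obtain ⟨M, N, h⟩ := exists_gromovProduct_le_of_not_jointlyDiverge hdB hΛ (a i).2 (a j).2
        fun h => ha i j hij (hCT.2 _ _ h)
      exact ⟨M, N, fun _ => h⟩
  choose M₁ N₁ h₁ using hexΓ
  choose M₂ N₂ h₂ using hexΛ
  obtain ⟨M, hM0, hM₁, hM₂⟩ := ((eventually_ge_atTop (0 : ℝ)).and
    ((eventually_all.2 fun i => eventually_all.2 fun j => eventually_ge_atTop (M₁ i j)).and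
    (eventually_all.2 fun i => eventually_all.2 fun j => eventually_ge_atTop (M₂ i j)))).exists
  obtain ⟨N, hN₁, hN₂⟩ :=
    ((eventually_all.2 fun i => eventually_all.2 fun j => eventually_ge_atTop (N₁ i j)).and
    (eventually_all.2 fun i => eventually_all.2 fun j => eventually_ge_atTop (N₂ i j))).exists
  obtain ⟨δ₁, hδ₁0, hδ₁⟩ := id hΓ
  obtain ⟨δ₂, hδ₂0, hδ₂⟩ := id hΛ
  -- Base point shift, plus separation constant, plus hyperbolicity error: `2 * δ₁` from changing
  -- representatives in `∂Γ`, `2 * δ₂` from selecting the pair in `Λ`.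
  obtain ⟨C₁, hC₁⟩ : ∃ C : ℝ, C = 2 * wordMetric A 1 p + M + 2 * δ₁ := ⟨_, rfl⟩
  obtain ⟨C₂, hC₂⟩ : ∃ C : ℝ, C = 2 * wordMetric B 1 o + M + 2 * δ₂ := ⟨_, rfl⟩
  have hC₁0 : 0 ≤ C₁ := by have := hdA.nonneg 1 p; rw [hC₁]; positivity
  have hs0 : 0 < s := by linarith
  have hr0 : 0 < r := by linarith
  refine ⟨k₁ * s ^ (-C₁), k₂ * r ^ C₂, by positivity, by positivity, fun n => ?_⟩
  obtain ⟨h, hhn, hhd⟩ := exists_eq_distortion (A := A) (B := B) hAfin hA n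
  obtain ⟨i, j, hij, hpair⟩ := exists_pair_le_gromovProduct hdB hδ₂ (fun i => (a i).1) (M := M)
    (N := N) (o := o) (fun i j hij m hm n hn =>
      (h₂ i j hij m ((hN₂ i j).trans hm) n ((hN₂ i j).trans hn)).trans (hM₂ i j)) (h⁻¹ * o)
  set u := (a i).translate hB h
  set v := (a j).translate hB h
  have hΛprod : ENNReal.ofReal (wordMetric B 1 h - C₂) ≤
      boundaryProduct (wordMetric B) o (GromovBoundary.lim u) (GromovBoundary.lim v) := by
    refine le_boundaryProduct_lim u v (N := N) fun m hm n hn => ?_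
    have h3 := hpair m hm n hn
    -- Translation by `h` carries the viewpoint `h⁻¹ * o` back to `o`.
    rw [← gromovProduct_mul_left (wordMetric_mul_left hB) h, mul_inv_cancel_left] at h3
    refine le_trans ?_ h3
    have := (displacement_bounds hB h o).2
    linarith
  have hΓprod : boundaryProduct (wordMetric A) p (inducedMap hCT (GromovBoundary.lim u))
      (inducedMap hCT (GromovBoundary.lim v)) ≤ ENNReal.ofReal (n + C₁) := by
    refine (boundaryProduct_lim_le hdA hΓ hδ₁ ⟨_, hCT.1 u⟩ ⟨_, hCT.1 v⟩
      (K := n + 2 * wordMetric A 1 p + M) (N := N) fun m hm l hl => ?_).trans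
      (ENNReal.ofReal_le_ofReal (by linarith))
    have e : gromovProduct (wordMetric A) p ((h * (a i).1 m : Λ) : Γ) ((h * (a j).1 l : Λ) : Γ) =
        gromovProduct (wordMetric A) ((h : Γ)⁻¹ * p) ((a i).1 m : Γ) ((a j).1 l : Γ) := by
      rw [← gromovProduct_mul_left (wordMetric_mul_left hA) (h : Γ) ((h : Γ)⁻¹ * p),
        mul_inv_cancel_left]
      push_cast; rfl
    change gromovProduct (wordMetric A) p ((h * (a i).1 m : Λ) : Γ) ((h * (a j).1 l : Λ) : Γ) ≤ _
    rw [e]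
    have h3 := gromovProduct_le_add hdA ((h : Γ)⁻¹ * p) p ((a i).1 m : Γ) ((a j).1 l : Γ)
    have h4 := (displacement_bounds hA (h : Γ) p).1
    have h5 := (h₁ i j hij m ((hN₁ i j).trans hm) l ((hN₁ i j).trans hl)).trans (hM₁ i j)
    have h6 : wordMetric A 1 (h : Γ) ≤ n := by unfold wordMetric; exact_mod_cast hhn
    rw [hdA.comm p] at h3
    linarith
  refine le_iSup₂_of_le (GromovBoundary.lim u) (GromovBoundary.lim v) (le_iSup_of_le ?_ ?_)
  · refine (hvΛ _ _).2.trans ?_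
    calc k₂ * negPow r _ ≤ k₂ * r ^ (-(wordMetric B 1 h - C₂)) := by
          gcongr; exact negPow_le_rpow_neg hr hΛprod
      _ = k₂ * r ^ C₂ / r ^ distortion Λ A B n := by
          rw [hhd, neg_sub, Real.rpow_sub hr0, wordMetric, Real.rpow_natCast, mul_div_assoc]
  · refine ENNReal.ofReal_le_ofReal (le_trans ?_ (hvΓ _ _).1)
    calc k₁ * s ^ (-C₁) / s ^ n = k₁ * s ^ (-(n + C₁)) := by
          rw [show -((n : ℝ) + C₁) = -C₁ - n by ring, Real.rpow_sub hs0 (-C₁), Real.rpow_natCast,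
            mul_div_assoc]
      _ ≤ _ := by gcongr; exact rpow_neg_le_negPow hs (by positivity) hΓprod
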